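/- Let $T\ge 1$, let $\mathcal X=\prod_{t=1}^T\mathcal X_t$ be a product of Polish spaces, and let $d$ be any metric on $\mathcal X$ that metrizes the product topology. Denote by $\mathcal P(\mathcal X)$ the set of Borel probability measures on $\mathcal X$. A coupling $\pi$ of $\mu,\nu\in\mathcal P(\mathcal X)$ is called bicausal if, for $(X,Y)\sim\pi$ and every $t\in\{1,\dots,T-1\}$, under $\pi$ the vector $(Y_1,\dots,Y_t)$ is conditionally independent of $X$ given $(X_1,\dots,X_t)$, and $(X_1,\dots,X_t)$ is conditionally independent of $Y$ given $(Y_1,\dots,Y_t)$. For $1\le p<\infty$ let $$\mathcal{AW}_p(\mu,\nu)=\inf_{\pi}\Big(\int_{\mathcal X\times\mathcal X}d(x,y)^p\,\pi(dx,dy)\Big)^{1/p}\in[0,\infty],$$ where the infimum is over all bicausal couplings $\pi$ of $\mu$ and $\nu$. Let $H(\nu|\mu)=\int_{\mathcal X}\log\frac{d\nu}{d\mu}\,d\nu\in[0,\infty]$ if $\nu\ll\mu$, and $H(\nu|\mu)=+\infty$ otherwise. Let $p>1$ and let $\mu\in\mathcal P(\mathcal X)$, $x_0\in\mathcal X$ and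 $\alpha>0$ be such that $\int_{\mathcal X}e^{\alpha d(x,x_0)^{2p}}\,\mu(dx)<\infty$. Then, for all $\nu\in\mathcal P(\mathcal X)$, $$\mathcal{AW}_p(\mu,\nu)^p\le\frac{2^{p-1}(2\sqrt T+1)}{\sqrt\alpha}\Big(1+\log\int_{\mathcal X}e^{\alpha d(x,x_0)^{2p}}\,\mu(dx)\Big)^{1/2}\sqrt{2H(\nu|\mu)}.$$ -/

import Mathlib

open MeasureTheory ProbabilityTheory InformationTheory
open scoped ENNReal

/-- The path `x` up to time `t`, that is `(x_1, …, x_t)` for a path `x = (x_1, …, x_T)`.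
(Time `s ∈ {1, …, T}` is the index `s - 1 : Fin T`.) -/
def pathUpTo {T : ℕ} {X : Fin T → Type*} (t : ℕ) (x : ∀ i, X i) :
    ∀ i : {i : Fin T // i.val < t}, X i.val :=
  fun i => x i.val

theorem measurable_pathUpTo {T : ℕ} {X : Fin T → Type*} [∀ i, MeasurableSpace (X i)] (t : ℕ) :
    Measurable (pathUpTo (X := X) t) :=
  measurable_pi_lambda _ fun i => measurable_pi_apply i.val

theorem measurable_pathUpTo_fst {T : ℕ} {X : Fin T → Type*} [∀ i, MeasurableSpace (X i)]
    (t : ℕ) : Measurable fun z : (∀ i, X i) × (∀ i, X i) => pathUpTo t z.1 :=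
  (measurable_pathUpTo t).comp measurable_fst

theorem measurable_pathUpTo_snd {T : ℕ} {X : Fin T → Type*} [∀ i, MeasurableSpace (X i)]
    (t : ℕ) : Measurable fun z : (∀ i, X i) × (∀ i, X i) => pathUpTo t z.2 :=
  (measurable_pathUpTo t).comp measurable_snd

/-- `π` is a bicausal coupling of `μ` and `ν`: it has marginals `μ` and `ν`, and, for
`(X, Y) ∼ π` and every `t ∈ {1, …, T - 1}`, under `π` the path `(Y_1, …, Y_t)` is independent of
`X` conditionally on `(X_1, …, X_t)`, and `(X_1, …, X_t)` is independent of `Y` conditionally on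
`(Y_1, …, Y_t)`. -/
structure IsBicausalCoupling {T : ℕ} {X : Fin T → Type*} [∀ i, MeasurableSpace (X i)]
    [∀ i, StandardBorelSpace (X i)] (π : Measure ((∀ i, X i) × (∀ i, X i)))
    [IsFiniteMeasure π] (μ ν : Measure (∀ i, X i)) : Prop where
  map_fst : π.map Prod.fst = μ
  map_snd : π.map Prod.snd = ν
  causal : ∀ t : ℕ, 1 ≤ t → t < T →
    CondIndepFun (MeasurableSpace.comap (fun z => pathUpTo t z.1) inferInstance)
      (measurable_pathUpTo_fst t).comap_le
      (fun z => pathUpTo t z.2) (fun z => z.1) π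
  anticausal : ∀ t : ℕ, 1 ≤ t → t < T →
    CondIndepFun (MeasurableSpace.comap (fun z => pathUpTo t z.2) inferInstance)
      (measurable_pathUpTo_snd t).comap_le
      (fun z => pathUpTo t z.1) (fun z => z.2) π

/-- The `p`-adapted Wasserstein distance between `μ` and `ν` for the metric `d`, with values in
`[0, ∞]`. -/
noncomputable def adaptedWasserstein {T : ℕ} {X : Fin T → Type*} [∀ i, MeasurableSpace (X i)]
    [∀ i, StandardBorelSpace (X i)] (d : (∀ i, X i) → (∀ i, X i) → ℝ) (p : ℝ)
    (μ ν : Measure (∀ i, X i)) : ℝ≥0∞ :=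
  ⨅ (π : ProbabilityMeasure ((∀ i, X i) × (∀ i, X i)))
    (_ : IsBicausalCoupling (π : Measure ((∀ i, X i) × (∀ i, X i))) μ ν),
    (∫⁻ z, ENNReal.ofReal (d z.1 z.2) ^ p ∂(π : Measure ((∀ i, X i) × (∀ i, X i)))) ^ (1 / p)

open scoped NNReal

/-!
If `ν` has density `D` with respect to `μ`, then `D` is a product over the times `s` of factors
`b s` that depend on the path up to time `s + 1` and have conditional mean one given the path up to
time `s`. Couple `μ` and `ν` step by step: as long as the two paths agree, let them take a common
next step with density `min 1 (b s)`, the largest possible one, and otherwise take conditionally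
independent steps with the normalized excess densities; once separated, they move independently.
Neither path anticipates the other, so this coupling is bicausal.

The transport cost vanishes unless the paths separate, and `d(x, y)^p` is at most
`2^(p - 1) (d(x, x₀)^p + d(y, x₀)^p)`, so only the integrals of the weight `d(·, x₀)^p` against the
densities `1 - w` and `D - w` of the separated mass matter, where `w = ∏ min 1 (b s)`. The density
`1 - w` is the sum over `s` of the mass lost at time `s`, so by the Cauchy–Schwarz inequality and
the chain rule for the relative entropy its `L²(μ)` norm is at most `√(2 T H(ν|μ))`. Since
`D - w ≤ (D - 1)⁺ + (1 - w)`, it remains to bound the weighted integral of `(D - 1)⁺`. This follows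
from a weighted Pinsker inequality, in which the exponential moment enters through the Gibbs
variational principle.
-/

section CondLExp

variable {Ω : Type*} {m mΩ : MeasurableSpace Ω} {μ : Measure Ω} {f g : Ω → ℝ≥0∞}

theorem lintegral_mul_condLExp (hm : m ≤ mΩ) [SigmaFinite (μ.trim hm)] (hg : Measurable[m] g)
    (hf : AEMeasurable f μ) : ∫⁻ z, g z * (μ⁻[f|m]) z ∂μ = ∫⁻ z, g z * f z ∂μ := by
  have hg' : Measurable g := hg.mono hm le_rfl
  have htrim : (μ.withDensity (μ⁻[f|m])).trim hm = (μ.withDensity f).trim hm := by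
    refine @Measure.ext _ m _ _ fun s hs => ?_
    rw [trim_measurableSet_eq hm hs, trim_measurableSet_eq hm hs, withDensity_apply _ (hm s hs),
      withDensity_apply _ (hm s hs), setLIntegral_condLExp hm μ f hs]
  calc ∫⁻ z, g z * (μ⁻[f|m]) z ∂μ = ∫⁻ z, g z ∂μ.withDensity (μ⁻[f|m]) := by
        simp only [lintegral_withDensity_eq_lintegral_mul μ (measurable_condLExp' m μ f) hg',
          Pi.mul_apply, mul_comm]
    _ = ∫⁻ z, g z ∂μ.withDensity f := by rw [← lintegral_trim hm hg, htrim, lintegral_trim hm hg]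
    _ = ∫⁻ z, g z * f z ∂μ := by
        simp only [lintegral_withDensity_eq_lintegral_mul₀ hf hg'.aemeasurable, Pi.mul_apply,
          mul_comm]

theorem condLExp_ae_eq_of_forall_lintegral_mul_eq (hm : m ≤ mΩ) [SigmaFinite (μ.trim hm)]
    (hfg : ∀ k : Ω → ℝ≥0∞, Measurable[m] k → ∫⁻ z, k z * f z ∂μ = ∫⁻ z, k z * g z ∂μ) :
    μ⁻[f|m] =ᵐ[μ] μ⁻[g|m] := by
  refine ae_eq_condLExp hm μ g (measurable_condLExp m μ f) fun s hs => ?_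
  have hk := hfg (s.indicator 1) (Measurable.indicator (@measurable_one _ _ _ m _) hs)
  simp only [← Set.indicator_mul_left, Pi.one_apply, one_mul,
    lintegral_indicator (hm s hs)] at hk
  rw [setLIntegral_condLExp hm μ f hs, hk]

theorem condLExp_mul_left (hm : m ≤ mΩ) [SigmaFinite (μ.trim hm)] (hg : Measurable[m] g)
    (hf : AEMeasurable f μ) : μ⁻[g * f|m] =ᵐ[μ] g * μ⁻[f|m] := by
  have hgf : Measurable[m] (g * μ⁻[f|m]) := hg.mul (measurable_condLExp m μ f)
  rw [← condLExp_eq_self hm μ hgf]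
  refine condLExp_ae_eq_of_forall_lintegral_mul_eq hm fun k hk => ?_
  simpa only [Pi.mul_apply, mul_assoc] using (lintegral_mul_condLExp hm (hk.mul hg) hf).symm

theorem eq_zero_of_condLExp_eq_zero (hm : m ≤ mΩ) [SigmaFinite (μ.trim hm)]
    (hf : AEMeasurable f μ) : ∀ᵐ z ∂μ, (μ⁻[f|m]) z = 0 → f z = 0 := by
  set N : Set Ω := (μ⁻[f|m]) ⁻¹' {0}
  have hN : Measurable[m] (N.indicator (1 : Ω → ℝ≥0∞)) :=
    Measurable.indicator (@measurable_one _ _ _ m _)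
      (measurable_condLExp m μ f (measurableSet_singleton 0))
  have hNf : ∫⁻ z, N.indicator 1 z * f z ∂μ = 0 := by
    rw [← lintegral_mul_condLExp hm hN hf]
    refine (lintegral_congr fun z => ?_).trans lintegral_zero
    by_cases hz : z ∈ N
    · rw [show (μ⁻[f|m]) z = 0 from hz, mul_zero]
    · rw [Set.indicator_of_notMem hz, zero_mul]
  filter_upwards [(lintegral_eq_zero_iff' ((hN.mono hm le_rfl).aemeasurable.mul hf)).1 hNf]
    with z hmul hz
  simpa [Set.indicator_of_mem (show z ∈ N from hz)] using hmul

theorem condLExp_mul_eq_zero (hm : m ≤ mΩ) [SigmaFinite (μ.trim hm)] (hf : AEMeasurable f μ)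
    (hg : AEMeasurable g μ) : ∀ᵐ z ∂μ, (μ⁻[f|m]) z = 0 → (μ⁻[f * g|m]) z = 0 := by
  set N : Set Ω := (μ⁻[f|m]) ⁻¹' {0}
  have hN : Measurable[m] (N.indicator (1 : Ω → ℝ≥0∞)) :=
    Measurable.indicator (@measurable_one _ _ _ m _)
      (measurable_condLExp m μ f (measurableSet_singleton 0))
  have hNfg : N.indicator 1 * (f * g) =ᵐ[μ] 0 := by
    filter_upwards [eq_zero_of_condLExp_eq_zero hm hf] with z hz
    by_cases hzN : z ∈ N
    · simp [hz hzN]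
    · simp [hzN]
  filter_upwards [condLExp_mul_left hm hN (hf.mul hg), condLExp_congr_ae (mΩ := m) hNfg]
    with z hmul hzero hz
  rw [hzero, condLExp_zero, Pi.mul_apply, Set.indicator_of_mem (show z ∈ N from hz)] at hmul
  simpa using hmul.symm

theorem condLExp_condLExp_of_le {m' : MeasurableSpace Ω} (hmm' : m ≤ m') (hm' : m' ≤ mΩ)
    [SigmaFinite (μ.trim hm')] [SigmaFinite (μ.trim (hmm'.trans hm'))] :
    μ⁻[μ⁻[f|m']|m] =ᵐ[μ] μ⁻[f|m] := by
  refine ae_eq_condLExp (hmm'.trans hm') μ f (measurable_condLExp _ _ _) fun s hs => ?_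
  rw [setLIntegral_condLExp _ μ _ hs, setLIntegral_condLExp hm' μ f (hmm' s hs)]

/-- Bayes' rule, in a form free of division. -/
theorem lintegral_mul_mul_condLExp_withDensity (hm : m ≤ mΩ) {D k : Ω → ℝ≥0∞}
    [SigmaFinite ((μ.withDensity D).trim hm)] (hD : Measurable D) (hf : Measurable f)
    (hk : Measurable[m] k) :
    ∫⁻ z, k z * (D z * ((μ.withDensity D)⁻[f|m]) z) ∂μ = ∫⁻ z, k z * (D z * f z) ∂μ := by
  have hk' : Measurable k := hk.mono hm le_rfl
  have : Measurable ((μ.withDensity D)⁻[f|m]) := measurable_condLExp' _ _ _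
  have key := lintegral_mul_condLExp (μ := μ.withDensity D) hm hk hf.aemeasurable
  rw [lintegral_withDensity_eq_lintegral_mul _ hD (by fun_prop),
    lintegral_withDensity_eq_lintegral_mul _ hD (by fun_prop)] at key
  simpa only [Pi.mul_apply, mul_left_comm] using key

theorem lintegral_condExpKernel_ae_eq [StandardBorelSpace Ω] [IsFiniteMeasure μ] (hm : m ≤ mΩ)
    (hf : Measurable f) : (fun z => ∫⁻ x, f x ∂condExpKernel μ m z) =ᵐ[μ] μ⁻[f|m] := by
  have hκf : Measurable[m] fun z => ∫⁻ x, f x ∂condExpKernel μ m z :=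
    @Measurable.lintegral_kernel Ω Ω m mΩ (condExpKernel μ m) f hf
  refine ae_eq_condLExp hm μ f hκf fun s hs => ?_
  have hf' : Measurable[m.prod mΩ] fun q : Ω × Ω => f q.2 := hf.comp (@measurable_snd _ _ m mΩ)
  have hdiag : @Measurable Ω (Ω × Ω) mΩ (m.prod mΩ) Function.diag :=
    @Measurable.prodMk Ω mΩ Ω Ω m mΩ _ _ (measurable_id'' hm) measurable_id
  have hset := @Measure.setLIntegral_compProd Ω Ω m mΩ (μ.trim hm) (condExpKernel μ m) _ _ _ hf'
    s hs Set.univ .univ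
  rw [compProd_trim_condExpKernel hm, @setLIntegral_map Ω (Ω × Ω) mΩ (m.prod mΩ) μ _ _ _
    (hs.prod .univ) hf' hdiag] at hset
  simpa [setLIntegral_trim hm hκf hs] using hset.symm

end CondLExp

section CondProd

variable {Ω : Type*} {m mΩ : MeasurableSpace Ω} [StandardBorelSpace Ω] {μ : Measure Ω}
  [IsFiniteMeasure μ]

/-- The measure on `Ω × Ω` under which, given a point `z` drawn with density `n`, the two
coordinates are independent with densities `p` and `q` with respect to the conditional law of `μ`
given `m` at `z`. -/
noncomputable def condProd (μ : Measure Ω) [IsFiniteMeasure μ] (hm : m ≤ mΩ)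
    (n p q : Ω → ℝ≥0∞) : Measure (Ω × Ω) :=
  let κ : Kernel Ω Ω := (condExpKernel μ m).comap id (measurable_id'' hm)
  ((μ ⊗ₘ (κ ×ₖ κ)).withDensity fun z => n z.1 * (p z.2.1 * q z.2.2)).map Prod.snd

theorem lintegral_condProd (hm : m ≤ mΩ) {n p q f g : Ω → ℝ≥0∞} (hn : Measurable n)
    (hp : Measurable p) (hq : Measurable q) (hf : Measurable f) (hg : Measurable g) :
    ∫⁻ z, f z.1 * g z.2 ∂condProd μ hm n p q =
      ∫⁻ z, n z * ((μ⁻[p * f|m]) z * (μ⁻[q * g|m]) z) ∂μ := by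
  rw [condProd, lintegral_map (by fun_prop) measurable_snd,
    lintegral_withDensity_eq_lintegral_mul _ (by fun_prop) (by fun_prop),
    Measure.lintegral_compProd (by fun_prop)]
  refine lintegral_congr_ae ?_
  filter_upwards [lintegral_condExpKernel_ae_eq (μ := μ) hm (hp.mul hf),
    lintegral_condExpKernel_ae_eq (μ := μ) hm (hq.mul hg)] with z hpf hqg
  simp only [Pi.mul_apply] at hpf hqg
  simp only [Pi.mul_apply, ← hpf, ← hqg]
  rw [← lintegral_prod_mul (by fun_prop) (by fun_prop), ← lintegral_const_mul _ (by fun_prop),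
    Kernel.prod_apply]
  exact lintegral_congr fun y => by ring

end CondProd

section DensityRatio

variable {Ω : Type*} {mΩ : MeasurableSpace Ω} {μ : Measure Ω} {F : Filtration ℕ mΩ}
  {a b : ℕ → Ω → ℝ≥0∞} {r s t T : ℕ}

/-- The density acquired between the times `s` and `t` by a process whose density with respect to a
reference measure is multiplied by `a i` at the step from time `i` to time `i + 1`. -/
noncomputable def transitionDensity (a : ℕ → Ω → ℝ≥0∞) (s t : ℕ) : Ω → ℝ≥0∞ :=
  ∏ i ∈ Finset.Ico s t, a i

theorem transitionDensity_self : transitionDensity a s s = 1 := by simp [transitionDensity]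

theorem transitionDensity_mul (hrs : r ≤ s) (hst : s ≤ t) :
    transitionDensity a r s * transitionDensity a s t = transitionDensity a r t :=
  Finset.prod_Ico_consecutive a hrs hst

theorem transitionDensity_succ (hst : s ≤ t) :
    transitionDensity a s (t + 1) = transitionDensity a s t * a t :=
  Finset.prod_Ico_succ_top hst a

theorem transitionDensity_eq_mul_succ (hst : s < t) :
    transitionDensity a s t = a s * transitionDensity a (s + 1) t :=
  Finset.prod_eq_prod_Ico_succ_bot hst a

theorem transitionDensity_inf_comm :
    transitionDensity (a ⊓ b) s t = transitionDensity (b ⊓ a) s t := by rw [inf_comm]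

theorem transitionDensity_inf_le : transitionDensity (a ⊓ b) s t ≤ transitionDensity a s t :=
  Finset.prod_le_prod' fun _ _ => inf_le_left

theorem measurable_transitionDensity (ha : ∀ s, Measurable[F (s + 1)] (a s)) :
    Measurable[F t] (transitionDensity a s t) := by
  rw [transitionDensity, Finset.prod_fn]
  exact Finset.measurable_prod _ fun i hi =>
    (ha i).mono (F.mono (Nat.succ_le_of_lt (Finset.mem_Ico.1 hi).2)) le_rfl

/-- The functions `a s` are the ratios of the densities at the successive times `s` and `s + 1`,
with respect to `μ`, of some measure. Working with the ratios avoids divisions by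
densities that vanish. -/
structure IsDensityRatio (μ : Measure Ω) (F : Filtration ℕ mΩ) (a : ℕ → Ω → ℝ≥0∞) : Prop where
  measurable : ∀ s, Measurable[F (s + 1)] (a s)
  condLExp_eq_one : ∀ s, μ⁻[a s|F s] =ᵐ[μ] 1

/-- The contribution to `transitionDensity a s T` of the part of `a s` that exceeds `b s`. -/
noncomputable def excessDensity (a b : ℕ → Ω → ℝ≥0∞) (s T : ℕ) : Ω → ℝ≥0∞ :=
  (a s - b s) * transitionDensity a (s + 1) T

theorem transitionDensity_inf_mul_excessDensity_add (a b : ℕ → Ω → ℝ≥0∞) (hst : s < T) :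
    transitionDensity (a ⊓ b) 0 s * excessDensity a b s T +
      transitionDensity (a ⊓ b) 0 (s + 1) * transitionDensity a (s + 1) T =
    transitionDensity (a ⊓ b) 0 s * transitionDensity a s T := by
  have hab : a s - b s + (a ⊓ b) s = a s := by ext z; exact tsub_add_min
  rw [transitionDensity_succ s.zero_le, transitionDensity_eq_mul_succ hst, excessDensity, mul_assoc,
    ← mul_add, ← add_mul, hab]

/-- The left-hand side sorts the mass not separated before time `t` by its time of separation. -/
theorem transitionDensity_inf_add_sum_excessDensity (a b : ℕ → Ω → ℝ≥0∞) (ht : t ≤ T) :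
    transitionDensity (a ⊓ b) 0 T +
        ∑ s ∈ Finset.Ico t T, transitionDensity (a ⊓ b) 0 s * excessDensity a b s T =
      transitionDensity (a ⊓ b) 0 t * transitionDensity a t T := by
  induction ht using Nat.decreasingInduction with
  | self => simp [transitionDensity_self]
  | of_succ t ht ih =>
    rw [Finset.sum_eq_sum_Ico_succ_bot ht, add_left_comm, ih,
      transitionDensity_inf_mul_excessDensity_add a b ht]

namespace IsDensityRatio

theorem measurable' (ha : IsDensityRatio μ F a) (s : ℕ) : Measurable (a s) :=
  (ha.measurable s).mono (F.le _) le_rfl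

theorem measurable_transitionDensity' (ha : IsDensityRatio μ F a) :
    Measurable (transitionDensity a s t) :=
  (measurable_transitionDensity ha.measurable).mono (F.le t) le_rfl

theorem measurable_inf (ha : IsDensityRatio μ F a) (hb : IsDensityRatio μ F b) :
    Measurable[F t] (transitionDensity (a ⊓ b) s t) :=
  measurable_transitionDensity fun s => (ha.measurable s).inf (hb.measurable s)

theorem measurable_inf' (ha : IsDensityRatio μ F a) (hb : IsDensityRatio μ F b) :
    Measurable (transitionDensity (a ⊓ b) s t) :=
  (ha.measurable_inf hb).mono (F.le t) le_rfl

theorem measurable_excessDensity (ha : IsDensityRatio μ F a) (hb : IsDensityRatio μ F b) :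
    Measurable (excessDensity a b s t) :=
  ((ha.measurable' s).sub (hb.measurable' s)).mul ha.measurable_transitionDensity'

theorem condLExp_sub_ae_ne_top (ha : IsDensityRatio μ F a) (b : ℕ → Ω → ℝ≥0∞) (s : ℕ) :
    ∀ᵐ z ∂μ, (μ⁻[a s - b s|F s]) z ≠ ∞ := by
  filter_upwards [condLExp_mono (mΩ := F s) (ae_of_all μ fun z => tsub_le_self (a := a s z)
    (b := b s z)), ha.condLExp_eq_one s] with z hz hz'
  exact ne_top_of_le_ne_top ENNReal.one_ne_top (hz.trans_eq hz')

theorem condLExp_sub_comm (ha : IsDensityRatio μ F a) (hb : IsDensityRatio μ F b) (s : ℕ) :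
    μ⁻[a s - b s|F s] =ᵐ[μ] μ⁻[b s - a s|F s] := by
  have hab : a s + (b s - a s) = b s + (a s - b s) := by
    ext z; simp only [Pi.add_apply, Pi.sub_apply, add_tsub_eq_max, max_comm]
  have ha' := condLExp_add_left (mΩ := F s) (b s - a s) (ha.measurable' s).aemeasurable (P := μ)
  have hb' := condLExp_add_left (mΩ := F s) (a s - b s) (hb.measurable' s).aemeasurable (P := μ)
  filter_upwards [ha', hb', ha.condLExp_eq_one s, hb.condLExp_eq_one s] with z ha' hb' ha1 hb1
  rw [hab, hb'] at ha'
  simpa [ha1, hb1] using ha'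

variable [IsFiniteMeasure μ]

theorem condLExp_transitionDensity (ha : IsDensityRatio μ F a) (hst : s ≤ t) :
    μ⁻[transitionDensity a s t|F s] =ᵐ[μ] 1 := by
  induction hst with
  | refl => rw [transitionDensity_self, condLExp_one (F.le s)]
  | @step t hst ih =>
    rw [transitionDensity_succ hst]
    refine (condLExp_condLExp_of_le (F.mono hst) (F.le t)).symm.trans (.trans ?_ ih)
    refine condLExp_congr_ae ?_
    filter_upwards [condLExp_mul_left (F.le t) (measurable_transitionDensity ha.measurable)
      (ha.measurable' t).aemeasurable, ha.condLExp_eq_one t] with z hz hz'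
    rw [hz, Pi.mul_apply, hz', Pi.one_apply, mul_one]

theorem lintegral_transitionDensity (ha : IsDensityRatio μ F a) (hst : s ≤ t) :
    ∫⁻ z, transitionDensity a s t z ∂μ = μ Set.univ := by
  rw [← lintegral_condLExp (F.le s), lintegral_congr_ae (ha.condLExp_transitionDensity hst)]
  simp

theorem transitionDensity_ae_ne_top (ha : IsDensityRatio μ F a) (hst : s ≤ t) :
    ∀ᵐ z ∂μ, transitionDensity a s t z ≠ ∞ := by
  refine (ae_lt_top ha.measurable_transitionDensity' ?_).mono fun _ h => h.ne
  rw [ha.lintegral_transitionDensity hst]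
  exact measure_ne_top _ _

theorem condLExp_excessDensity (ha : IsDensityRatio μ F a) (hb : IsDensityRatio μ F b)
    (hst : s < T) : μ⁻[excessDensity a b s T|F s] =ᵐ[μ] μ⁻[a s - b s|F s] := by
  refine (condLExp_condLExp_of_le (F.mono s.le_succ) (F.le _)).symm.trans
    (condLExp_congr_ae ?_)
  filter_upwards [condLExp_mul_left (F.le (s + 1)) ((ha.measurable s).sub (hb.measurable s))
    ha.measurable_transitionDensity'.aemeasurable, ha.condLExp_transitionDensity hst] with z hz hz'
  rw [excessDensity, hz, Pi.mul_apply, hz', Pi.one_apply, mul_one]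

theorem lintegral_mul_transitionDensity_mul_condLExp (ha : IsDensityRatio μ F a) {c f k : Ω → ℝ≥0∞}
    (hsT : s ≤ T) (hst : s ≤ t) (hc : Measurable[F s] c) (hca : c ≤ transitionDensity a 0 s)
    (hf : Measurable f) (hk : Measurable[F t] k) :
    ∫⁻ z, k z * (c z * transitionDensity a s T z *
        ((μ.withDensity (transitionDensity a 0 T))⁻[f|F t]) z) ∂μ =
      ∫⁻ z, k z * (c z * transitionDensity a s T z * f z) ∂μ := by
  have : IsFiniteMeasure (μ.withDensity (transitionDensity a 0 T)) := by
    refine isFiniteMeasure_withDensity ?_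
    rw [ha.lintegral_transitionDensity T.zero_le]
    exact measure_ne_top _ _
  have hquot : Measurable[F t] (k * (c / transitionDensity a 0 s)) :=
    hk.mul ((hc.div (measurable_transitionDensity ha.measurable)).mono (F.mono hst) le_rfl)
  have hchange : ∀ u : Ω → ℝ≥0∞, ∫⁻ z, k z * (c z * transitionDensity a s T z * u z) ∂μ =
      ∫⁻ z, (k * (c / transitionDensity a 0 s)) z * (transitionDensity a 0 T z * u z) ∂μ := by
    refine fun u => lintegral_congr_ae ?_
    filter_upwards [ha.transitionDensity_ae_ne_top s.zero_le] with z hz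
    have hcancel : c z / transitionDensity a 0 s z * transitionDensity a 0 s z = c z :=
      ENNReal.div_mul_cancel' (fun h0 => le_zero_iff.1 (h0 ▸ hca z)) fun h => absurd h hz
    rw [← transitionDensity_mul s.zero_le hsT]
    simp only [Pi.mul_apply, Pi.div_apply]
    nth_rw 1 [← hcancel]
    ring
  rw [hchange, hchange, lintegral_mul_mul_condLExp_withDensity (F.le t)
    ha.measurable_transitionDensity' hf hquot]

end IsDensityRatio

end DensityRatio

section SeparationCoupling

variable {Ω : Type*} {mΩ : MeasurableSpace Ω} [StandardBorelSpace Ω] {μ : Measure Ω}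
  [IsFiniteMeasure μ] {F : Filtration ℕ mΩ} {a b : ℕ → Ω → ℝ≥0∞} {s t T : ℕ} {f g : Ω → ℝ≥0∞}

/-- The part of `separationCoupling` on which the two processes separate at time `s`: they have
moved together so far, and move on independently given the past. -/
noncomputable def separatedPart (μ : Measure Ω) [IsFiniteMeasure μ] (F : Filtration ℕ mΩ) (T : ℕ)
    (a b : ℕ → Ω → ℝ≥0∞) (s : ℕ) : Measure (Ω × Ω) :=
  condProd μ (F.le s) (transitionDensity (a ⊓ b) 0 s * (μ⁻[a s - b s|F s])⁻¹)
    (excessDensity a b s T) (excessDensity b a s T)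

/-- The coupling of the processes with density ratios `a` and `b` with respect to `μ` which, as long
as the processes have not separated, couples their next steps maximally given the past. The
processes move together with density `a s ⊓ b s`, and once separated they move independently. -/
noncomputable def separationCoupling (μ : Measure Ω) [IsFiniteMeasure μ] (F : Filtration ℕ mΩ)
    (T : ℕ) (a b : ℕ → Ω → ℝ≥0∞) : Measure (Ω × Ω) :=
  (μ.withDensity (transitionDensity (a ⊓ b) 0 T)).map Function.diag +
    ∑ s ∈ Finset.range T, separatedPart μ F T a b s

namespace IsDensityRatio

theorem lintegral_separatedPart (ha : IsDensityRatio μ F a) (hb : IsDensityRatio μ F b)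
    (hf : Measurable f) (hg : Measurable g) :
    ∫⁻ z, f z.1 * g z.2 ∂separatedPart μ F T a b s =
      ∫⁻ z, transitionDensity (a ⊓ b) 0 s z * ((μ⁻[a s - b s|F s]) z)⁻¹ *
        ((μ⁻[excessDensity a b s T * f|F s]) z * (μ⁻[excessDensity b a s T * g|F s]) z) ∂μ :=
  lintegral_condProd (F.le s) ((ha.measurable_inf' hb).mul (measurable_condLExp' _ _ _).inv)
    (ha.measurable_excessDensity hb) (hb.measurable_excessDensity ha) hf hg

theorem lintegral_separatedPart_swap (ha : IsDensityRatio μ F a) (hb : IsDensityRatio μ F b)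
    (hf : Measurable f) (hg : Measurable g) :
    ∫⁻ z, f z.1 * g z.2 ∂separatedPart μ F T a b s =
      ∫⁻ z, g z.1 * f z.2 ∂separatedPart μ F T b a s := by
  rw [ha.lintegral_separatedPart hb hf hg, hb.lintegral_separatedPart ha hg hf]
  refine lintegral_congr_ae ?_
  filter_upwards [ha.condLExp_sub_comm hb s] with z hz
  rw [transitionDensity_inf_comm, hz, mul_comm ((μ⁻[_ * f|F s]) z)]

theorem lintegral_separatedPart_of_measurable (ha : IsDensityRatio μ F a)
    (hb : IsDensityRatio μ F b) (hs : s < T) (hf : Measurable f) (hg : Measurable[F s] g) :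
    ∫⁻ z, f z.1 * g z.2 ∂separatedPart μ F T a b s =
      ∫⁻ z, transitionDensity (a ⊓ b) 0 s z * excessDensity a b s T z * (f z * g z) ∂μ := by
  have hp := ha.measurable_excessDensity hb (s := s) (t := T)
  have hq := hb.measurable_excessDensity ha (s := s) (t := T)
  have hw := (ha.measurable_inf hb (s := 0) (t := s)).mul hg
  calc ∫⁻ z, f z.1 * g z.2 ∂separatedPart μ F T a b s
    _ = ∫⁻ z, transitionDensity (a ⊓ b) 0 s z * g z *
          (μ⁻[excessDensity a b s T * f|F s]) z ∂μ := by
        rw [ha.lintegral_separatedPart hb hf (hg.mono (F.le s) le_rfl)]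
        refine lintegral_congr_ae ?_
        filter_upwards [ha.condLExp_sub_ae_ne_top b s, ha.condLExp_sub_comm hb s,
          ha.condLExp_excessDensity hb hs, hb.condLExp_excessDensity ha hs,
          condLExp_mul_left (F.le s) hg hq.aemeasurable,
          condLExp_mul_eq_zero (F.le s) hp.aemeasurable hf.aemeasurable]
          with z htop hcomm hpn hqn hqg hzero
        rw [mul_comm _ g, hqg, Pi.mul_apply, hqn, ← hcomm]
        by_cases hn : (μ⁻[a s - b s|F s]) z = 0
        · rw [hzero (hpn.trans hn)]
          simp only [zero_mul, mul_zero]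
        · rw [← mul_one (_ * g z), ← ENNReal.inv_mul_cancel hn htop]
          ring
    _ = _ := by
        refine (lintegral_mul_condLExp (F.le s) hw (hp.mul hf).aemeasurable).trans
          (lintegral_congr fun z => ?_)
        simp only [Pi.mul_apply]
        ring

theorem lintegral_separationCoupling (ha : IsDensityRatio μ F a) (hb : IsDensityRatio μ F b)
    {Φ : Ω × Ω → ℝ≥0∞} (hΦ : Measurable Φ) :
    ∫⁻ z, Φ z ∂separationCoupling μ F T a b =
      ∫⁻ z, transitionDensity (a ⊓ b) 0 T z * Φ (z, z) ∂μ +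
        ∑ s ∈ Finset.range T, ∫⁻ z, Φ z ∂separatedPart μ F T a b s := by
  rw [separationCoupling, lintegral_add_measure, lintegral_finsetSum_measure,
    lintegral_map hΦ (by fun_prop),
    lintegral_withDensity_eq_lintegral_mul _ (ha.measurable_inf' hb) (by fun_prop)]
  rfl

theorem lintegral_separationCoupling_swap (ha : IsDensityRatio μ F a) (hb : IsDensityRatio μ F b)
    (hf : Measurable f) (hg : Measurable g) :
    ∫⁻ z, f z.1 * g z.2 ∂separationCoupling μ F T a b =
      ∫⁻ z, g z.1 * f z.2 ∂separationCoupling μ F T b a := by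
  rw [ha.lintegral_separationCoupling hb (by fun_prop),
    hb.lintegral_separationCoupling ha (by fun_prop), transitionDensity_inf_comm,
    Finset.sum_congr rfl fun s _ => ha.lintegral_separatedPart_swap hb hf hg]
  simp only [mul_comm (f _)]

theorem lintegral_add_sum_separatedPart (ha : IsDensityRatio μ F a) (hb : IsDensityRatio μ F b)
    (ht : t ≤ T) (hf : Measurable f) (hg : Measurable[F t] g) :
    ∫⁻ z, transitionDensity (a ⊓ b) 0 T z * (f z * g z) ∂μ +
        ∑ s ∈ Finset.Ico t T, ∫⁻ z, f z.1 * g z.2 ∂separatedPart μ F T a b s =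
      ∫⁻ z, transitionDensity (a ⊓ b) 0 t z * transitionDensity a t T z * (f z * g z) ∂μ := by
  have hg' : Measurable g := hg.mono (F.le t) le_rfl
  have hw := fun s => ha.measurable_inf' hb (s := 0) (t := s)
  have hp := fun s => ha.measurable_excessDensity hb (s := s) (t := T)
  have hpart : ∀ s ∈ Finset.Ico t T, ∫⁻ z, f z.1 * g z.2 ∂separatedPart μ F T a b s =
      ∫⁻ z, transitionDensity (a ⊓ b) 0 s z * excessDensity a b s T z * (f z * g z) ∂μ :=
    fun s hs => ha.lintegral_separatedPart_of_measurable hb (Finset.mem_Ico.1 hs).2 hf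
      (hg.mono (F.mono (Finset.mem_Ico.1 hs).1) le_rfl)
  rw [Finset.sum_congr rfl hpart, ← lintegral_finsetSum _ fun s _ => by fun_prop,
    ← lintegral_add_left (by fun_prop)]
  refine lintegral_congr fun z => ?_
  have hz := congrFun (transitionDensity_inf_add_sum_excessDensity a b ht) z
  simp only [Pi.add_apply, Finset.sum_apply, Pi.mul_apply] at hz
  rw [← hz, add_mul, Finset.sum_mul]

theorem lintegral_separationCoupling_fst (ha : IsDensityRatio μ F a) (hb : IsDensityRatio μ F b)
    (hf : Measurable f) :
    ∫⁻ z, f z.1 ∂separationCoupling μ F T a b = ∫⁻ z, transitionDensity a 0 T z * f z ∂μ := by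
  have hsum := ha.lintegral_add_sum_separatedPart hb T.zero_le hf (@measurable_const _ _ _ (F 0) 1)
  simp only [mul_one, transitionDensity_self, Pi.one_apply, one_mul] at hsum
  rw [ha.lintegral_separationCoupling hb (by fun_prop), Finset.range_eq_Ico, hsum]

theorem map_fst_separationCoupling (ha : IsDensityRatio μ F a) (hb : IsDensityRatio μ F b) :
    (separationCoupling μ F T a b).map Prod.fst = μ.withDensity (transitionDensity a 0 T) := by
  refine Measure.ext_of_lintegral _ fun f hf => ?_
  rw [lintegral_map hf measurable_fst, ha.lintegral_separationCoupling_fst hb hf,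
    lintegral_withDensity_eq_lintegral_mul _ ha.measurable_transitionDensity' hf]
  rfl

theorem map_snd_separationCoupling (ha : IsDensityRatio μ F a) (hb : IsDensityRatio μ F b) :
    (separationCoupling μ F T a b).map Prod.snd = μ.withDensity (transitionDensity b 0 T) := by
  rw [← hb.map_fst_separationCoupling ha]
  refine Measure.ext_of_lintegral _ fun f hf => ?_
  rw [lintegral_map hf measurable_snd, lintegral_map hf measurable_fst]
  simpa only [one_mul, mul_one] using
    ha.lintegral_separationCoupling_swap hb (measurable_const (a := 1)) hf

theorem lintegral_separatedPart_condLExp (ha : IsDensityRatio μ F a) (hb : IsDensityRatio μ F b)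
    (hst : s < t) (htT : t ≤ T) (hf : Measurable f) (hg : Measurable g) :
    ∫⁻ z, ((μ.withDensity (transitionDensity a 0 T))⁻[f|F t]) z.1 * g z.2
        ∂separatedPart μ F T a b s =
      ∫⁻ z, f z.1 * g z.2 ∂separatedPart μ F T a b s := by
  set f' : Ω → ℝ≥0∞ := (μ.withDensity (transitionDensity a 0 T))⁻[f|F t]
  have hf' : Measurable f' := measurable_condLExp' _ _ _
  have hp : Measurable (excessDensity a b s T) := ha.measurable_excessDensity hb
  set w : Ω → ℝ≥0∞ := transitionDensity (a ⊓ b) 0 s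
  have hw : Measurable[F s] w := ha.measurable_inf hb
  have hc : Measurable[F (s + 1)] (w * (a s - b s)) :=
    (hw.mono (F.mono s.le_succ) le_rfl).mul ((ha.measurable s).sub (hb.measurable s))
  have hca : w * (a s - b s) ≤ transitionDensity a 0 (s + 1) := by
    rw [transitionDensity_succ s.zero_le]
    exact mul_le_mul' transitionDensity_inf_le tsub_le_self
  have hcond : μ⁻[w * (excessDensity a b s T * f')|F s] =ᵐ[μ]
      μ⁻[w * (excessDensity a b s T * f)|F s] := by
    refine condLExp_ae_eq_of_forall_lintegral_mul_eq (F.le s) fun k hk => ?_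
    simpa only [excessDensity, Pi.mul_apply, mul_assoc] using
      ha.lintegral_mul_transitionDensity_mul_condLExp (hst.trans_le htT) hst hc hca hf
        (hk.mono (F.mono hst.le) le_rfl)
  rw [ha.lintegral_separatedPart hb hf' hg, ha.lintegral_separatedPart hb hf hg]
  refine lintegral_congr_ae ?_
  filter_upwards [hcond, condLExp_mul_left (F.le s) hw (hp.mul hf').aemeasurable,
    condLExp_mul_left (F.le s) hw (hp.mul hf).aemeasurable] with z hz hz₁ hz₂
  rw [hz₁, hz₂, Pi.mul_apply, Pi.mul_apply] at hz
  rw [mul_right_comm, ← mul_assoc, hz]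
  ring

/-- Under the coupling, the second process up to time `t` depends on the first one only through its
past up to time `t`. -/
theorem lintegral_separationCoupling_condLExp (ha : IsDensityRatio μ F a)
    (hb : IsDensityRatio μ F b) (ht : t ≤ T) (hf : Measurable f) (hg : Measurable[F t] g) :
    ∫⁻ z, ((μ.withDensity (transitionDensity a 0 T))⁻[f|F t]) z.1 * g z.2
        ∂separationCoupling μ F T a b =
      ∫⁻ z, f z.1 * g z.2 ∂separationCoupling μ F T a b := by
  have hg' : Measurable g := hg.mono (F.le t) le_rfl
  have hfν := measurable_condLExp' (F t) (μ.withDensity (transitionDensity a 0 T)) f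
  rw [ha.lintegral_separationCoupling hb (by fun_prop),
    ha.lintegral_separationCoupling hb (by fun_prop), ← Finset.sum_range_add_sum_Ico _ ht,
    ← Finset.sum_range_add_sum_Ico _ ht, add_left_comm, add_left_comm (lintegral _ _),
    ha.lintegral_add_sum_separatedPart hb ht hfν hg,
    ha.lintegral_add_sum_separatedPart hb ht hf hg]
  congr 1
  · refine Finset.sum_congr rfl fun s hs => ?_
    exact ha.lintegral_separatedPart_condLExp hb (Finset.mem_range.1 hs) ht hf hg'
  · have key := ha.lintegral_mul_transitionDensity_mul_condLExp ht le_rfl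
      (ha.measurable_inf hb) (transitionDensity_inf_le (b := b)) hf hg
    simpa only [mul_comm (g _), mul_assoc] using key

theorem sum_lintegral_separatedPart_fst (ha : IsDensityRatio μ F a) (hb : IsDensityRatio μ F b)
    (hf : Measurable f) :
    ∑ s ∈ Finset.range T, ∫⁻ z, f z.1 ∂separatedPart μ F T a b s =
      ∫⁻ z, f z * (transitionDensity a 0 T z - transitionDensity (a ⊓ b) 0 T z) ∂μ := by
  have hw := fun s => ha.measurable_inf' hb (s := 0) (t := s)
  have hp := fun s => ha.measurable_excessDensity hb (s := s) (t := T)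
  have hpart : ∀ s ∈ Finset.range T, ∫⁻ z, f z.1 ∂separatedPart μ F T a b s =
      ∫⁻ z, transitionDensity (a ⊓ b) 0 s z * excessDensity a b s T z * f z ∂μ := fun s hs => by
    simpa only [mul_one] using ha.lintegral_separatedPart_of_measurable hb (Finset.mem_range.1 hs)
      hf (@measurable_const _ _ _ (F s) 1)
  rw [Finset.sum_congr rfl hpart, ← lintegral_finsetSum _ fun s _ => by fun_prop]
  refine lintegral_congr_ae ?_
  filter_upwards [ha.transitionDensity_ae_ne_top T.zero_le] with z hz
  have hsum := congrFun (transitionDensity_inf_add_sum_excessDensity a b T.zero_le) z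
  simp only [Pi.add_apply, Finset.sum_apply, Pi.mul_apply, transitionDensity_self, Pi.one_apply,
    one_mul, ← Finset.range_eq_Ico] at hsum
  rw [← Finset.sum_mul, mul_comm, ← hsum, ENNReal.add_sub_cancel_left
    (ne_top_of_le_ne_top hz (transitionDensity_inf_le z))]

theorem lintegral_separationCoupling_le (ha : IsDensityRatio μ F a) (hb : IsDensityRatio μ F b)
    {Φ : Ω × Ω → ℝ≥0∞} (hΦ : Measurable Φ) {φ : Ω → ℝ≥0∞} (hφ : Measurable φ) {C : ℝ≥0∞}
    (hdiag : ∀ z, Φ (z, z) = 0) (hle : ∀ z, Φ z ≤ C * (φ z.1 + φ z.2)) :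
    ∫⁻ z, Φ z ∂separationCoupling μ F T a b ≤
      C * (∫⁻ z, φ z * (transitionDensity a 0 T z - transitionDensity (a ⊓ b) 0 T z) ∂μ +
        ∫⁻ z, φ z * (transitionDensity b 0 T z - transitionDensity (a ⊓ b) 0 T z) ∂μ) := by
  have hswap : ∀ s, ∫⁻ z, φ z.2 ∂separatedPart μ F T a b s =
      ∫⁻ z, φ z.1 ∂separatedPart μ F T b a s := fun s => by
    simpa only [one_mul, mul_one] using
      ha.lintegral_separatedPart_swap hb (measurable_const (a := 1)) hφ
  calc ∫⁻ z, Φ z ∂separationCoupling μ F T a b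
    _ = ∑ s ∈ Finset.range T, ∫⁻ z, Φ z ∂separatedPart μ F T a b s := by
        simp [ha.lintegral_separationCoupling hb hΦ, hdiag]
    _ ≤ ∑ s ∈ Finset.range T, ∫⁻ z, C * (φ z.1 + φ z.2) ∂separatedPart μ F T a b s :=
        Finset.sum_le_sum fun s _ => lintegral_mono hle
    _ = C * (∑ s ∈ Finset.range T, ∫⁻ z, φ z.1 ∂separatedPart μ F T a b s +
          ∑ s ∈ Finset.range T, ∫⁻ z, φ z.1 ∂separatedPart μ F T b a s) := by
        rw [← Finset.sum_add_distrib, Finset.mul_sum]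
        refine Finset.sum_congr rfl fun s _ => ?_
        rw [lintegral_const_mul _ (by fun_prop), lintegral_add_left (by fun_prop), hswap]
    _ = _ := by
        rw [ha.sum_lintegral_separatedPart_fst hb hφ, hb.sum_lintegral_separatedPart_fst ha hφ,
          transitionDensity_inf_comm (a := b)]

theorem isProbabilityMeasure_separationCoupling {μ : Measure Ω} [IsProbabilityMeasure μ]
    (ha : IsDensityRatio μ F a) (hb : IsDensityRatio μ F b) :
    IsProbabilityMeasure (separationCoupling μ F T a b) where
  measure_univ := by
    have hone := ha.lintegral_separationCoupling_fst hb (T := T) (measurable_const (a := 1))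
    simpa [ha.lintegral_transitionDensity T.zero_le] using hone

end IsDensityRatio

end SeparationCoupling

section CondIndep

variable {E Ω γ : Type*} {m : MeasurableSpace E} {mE : MeasurableSpace E} {n : MeasurableSpace Ω}
  {mΩ : MeasurableSpace Ω} [MeasurableSpace γ] {π : Measure E} [IsFiniteMeasure π] {X Y : E → Ω}

theorem condLExp_map_comp_ae_eq (hX : Measurable X) (hn : n ≤ mΩ) {f : Ω → ℝ≥0∞}
    (hf : Measurable f) : (π.map X)⁻[f|n] ∘ X =ᵐ[π] π⁻[f ∘ X|n.comap X] := by
  have hnX : n.comap X ≤ mE := (MeasurableSpace.comap_mono hn).trans hX.comap_le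
  refine ae_eq_condLExp hnX π _ ((measurable_condLExp n _ f).comp (comap_measurable X)) ?_
  rintro _ ⟨s, hs, rfl⟩
  have hmap := setLIntegral_condLExp hn (π.map X) f hs
  rw [setLIntegral_map (hn s hs) (measurable_condLExp' n _ f) hX,
    setLIntegral_map (hn s hs) hf hX] at hmap
  exact hmap

theorem toReal_condLExp_indicator_one {s : Set E} (hs : MeasurableSet s) :
    (fun e => ((π⁻[s.indicator 1|m]) e).toReal) =ᵐ[π] π⟦s|m⟧ := by
  have hreal : (fun e => (s.indicator (1 : E → ℝ≥0∞) e).toReal) =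
      s.indicator fun _ => (1 : ℝ) := by
    ext e
    by_cases he : e ∈ s <;> simp [he]
  rw [← hreal]
  refine toReal_condLExp m (measurable_one.indicator hs).aemeasurable ?_
  rw [lintegral_indicator_one hs]
  exact measure_ne_top _ _

theorem condLExp_mul_comp_of_lintegral_condLExp (hX : Measurable X) (hY : Measurable Y)
    (hn : n ≤ mΩ)
    (h : ∀ f g : Ω → ℝ≥0∞, Measurable f → Measurable[n] g →
      ∫⁻ e, ((π.map X)⁻[f|n]) (X e) * g (Y e) ∂π = ∫⁻ e, f (X e) * g (Y e) ∂π)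
    {f g : Ω → ℝ≥0∞} (hf : Measurable f) (hg : Measurable[n] g) :
    π⁻[(f ∘ X) * (g ∘ Y)|n.comap X] =ᵐ[π] π⁻[f ∘ X|n.comap X] * π⁻[g ∘ Y|n.comap X] := by
  have hnX : n.comap X ≤ mE := (MeasurableSpace.comap_mono hn).trans hX.comap_le
  have hf' : Measurable[n.comap X] ((π.map X)⁻[f|n] ∘ X) :=
    (measurable_condLExp n _ f).comp (comap_measurable X)
  have hmove : π⁻[((π.map X)⁻[f|n] ∘ X) * (g ∘ Y)|n.comap X] =ᵐ[π]
      π⁻[(f ∘ X) * (g ∘ Y)|n.comap X] := by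
    refine condLExp_ae_eq_of_forall_lintegral_mul_eq hnX fun k hk => ?_
    obtain ⟨k', hk', rfl⟩ := @Measurable.exists_eq_measurable_comp _ _ _ n _ _ _ _ _ hk
    have hpull := ae_of_ae_map hX.aemeasurable
      (condLExp_mul_left (μ := π.map X) hn hk' hf.aemeasurable)
    rw [lintegral_congr_ae (g := fun e => ((π.map X)⁻[k' * f|n]) (X e) * g (Y e)) ?_,
      h _ _ ((hk'.mono hn le_rfl).mul hf) hg]
    · simp only [Function.comp_apply, Pi.mul_apply, mul_assoc]
    · filter_upwards [hpull] with e he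
      rw [he]
      simp only [Function.comp_apply, Pi.mul_apply, mul_assoc]
  refine hmove.symm.trans ((condLExp_mul_left hnX hf' ?_).trans ?_)
  · exact ((hg.mono hn le_rfl).comp hY).aemeasurable
  · exact (condLExp_map_comp_ae_eq hX hn hf).mul (ae_eq_refl _)

theorem condIndepFun_of_lintegral_condLExp [StandardBorelSpace E] (hX : Measurable X)
    (hY : Measurable Y) {u : Ω → γ} (hu : Measurable u)
    (h : ∀ f g : Ω → ℝ≥0∞, Measurable f → Measurable[MeasurableSpace.comap u inferInstance] g →
      ∫⁻ e, ((π.map X)⁻[f|MeasurableSpace.comap u inferInstance]) (X e) * g (Y e) ∂π =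
        ∫⁻ e, f (X e) * g (Y e) ∂π) :
    CondIndepFun (MeasurableSpace.comap (fun e => u (X e)) inferInstance) (hu.comp hX).comap_le
      (fun e => u (Y e)) X π := by
  refine (condIndepFun_iff_condExp_inter_preimage_eq_mul (hu.comp hY) hX).2 fun B C hB hC => ?_
  have hA : MeasurableSet ((fun e => u (Y e)) ⁻¹' B) := (hu.comp hY) hB
  have hmul := condLExp_mul_comp_of_lintegral_condLExp hX hY hu.comap_le h
    (measurable_one.indicator hC)
    (Measurable.indicator (@measurable_one _ _ _ (MeasurableSpace.comap u inferInstance) _)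
      ⟨B, hB, rfl⟩)
  have hinter : ((fun e => u (Y e)) ⁻¹' B ∩ X ⁻¹' C).indicator (1 : E → ℝ≥0∞) =
      (C.indicator 1 ∘ X) * ((u ⁻¹' B).indicator 1 ∘ Y) := by
    rw [Set.inter_comm]
    exact Set.inter_indicator_one
  rw [MeasurableSpace.comap_comp, ← hinter] at hmul
  have htoReal {s : Set E} (hs : MeasurableSet s) :=
    toReal_condLExp_indicator_one (π := π) (m := MeasurableSpace.comap (u ∘ X) inferInstance) hs
  filter_upwards [hmul, htoReal (hA.inter (hX hC)), htoReal hA, htoReal (hX hC)]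
    with e hmul hAC hA hC
  refine hAC.symm.trans (.trans ?_ (congrArg₂ (· * ·) hA hC))
  rw [hmul, mul_comm]
  exact ENNReal.toReal_mul

end CondIndep

section Entropy

/-- The integrand `x log x + 1 - x` of the Kullback–Leibler divergence, as a function of a density
with values in `[0, ∞]`. Its value at `∞` is the junk value `1`; integrable densities are almost
everywhere finite. -/
noncomputable def eklFun (x : ℝ≥0∞) : ℝ≥0∞ := ENNReal.ofReal (klFun x.toReal)

theorem eklFun_coe (x : ℝ≥0) : eklFun x = ENNReal.ofReal (klFun x) := rfl

@[fun_prop]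
theorem measurable_eklFun : Measurable eklFun :=
  (measurable_klFun.comp ENNReal.measurable_toReal).ennreal_ofReal

theorem eklFun_one : eklFun 1 = 0 := by simp [eklFun, klFun_one]

theorem eklFun_mul_add_add {x y : ℝ≥0∞} (hx : x ≠ ∞) (hy : y ≠ ∞) :
    eklFun (x * y) + x + y = y * eklFun x + x * eklFun y + 1 + x * y := by
  lift x to ℝ≥0 using hx
  lift y to ℝ≥0 using hy
  have hklFun : klFun (x * y) + x + y = y * klFun x + x * klFun y + 1 + x * y := by
    rcases eq_or_ne (x : ℝ) 0 with hx | hx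
    · simp only [hx, klFun]; ring
    rcases eq_or_ne (y : ℝ) 0 with hy | hy
    · simp only [hy, klFun]; ring
    simp only [klFun, Real.log_mul hx hy]
    ring
  have hx₀ : 0 ≤ klFun x := klFun_nonneg x.2
  have hy₀ : 0 ≤ klFun y := klFun_nonneg y.2
  have hxy₀ : 0 ≤ klFun (x * y) := klFun_nonneg (by positivity)
  rw [← ENNReal.coe_mul, eklFun_coe, eklFun_coe, eklFun_coe]
  simp only [← ENNReal.ofReal_coe_nnreal, ← ENNReal.ofReal_one, NNReal.coe_mul]
  simp (disch := positivity) only [← ENNReal.ofReal_mul, ← ENNReal.ofReal_add]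
  exact congrArg _ hklFun

theorem sq_one_sub_le_two_mul_klFun {x : ℝ} (hx₀ : 0 ≤ x) (hx₁ : x ≤ 1) :
    (1 - x) ^ 2 ≤ 2 * klFun x := by
  rcases hx₀.eq_or_lt with rfl | hx₀
  · norm_num [klFun]
  have hlog : -Real.log x ≤ (x⁻¹ - x) / 2 := by
    have hsinh := Real.self_le_sinh_iff.2 (Real.log_nonneg ((one_le_inv₀ hx₀).2 hx₁))
    rwa [Real.sinh_log (inv_pos.2 hx₀), Real.log_inv, inv_inv] at hsinh
  have hxlog : x * -Real.log x ≤ (1 - x ^ 2) / 2 := by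
    refine (mul_le_mul_of_nonneg_left hlog hx₀.le).trans_eq ?_
    field_simp
  rw [klFun]
  linarith

theorem sq_sub_one_le_two_mul_self_mul_klFun {x : ℝ} (hx : 1 ≤ x) :
    (x - 1) ^ 2 ≤ 2 * x * klFun x := by
  have hlog : 2 * (x - 1) ≤ Real.log x * (x + 1) := by
    have := Real.le_log_one_add_of_nonneg (sub_nonneg.2 hx)
    rwa [add_sub_cancel, show x - 1 + 2 = x + 1 by ring, div_le_iff₀ (by linarith)] at this
  have hsq : (x - 1) ^ 2 ≤ (x + 1) * klFun x := by
    rw [klFun]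
    nlinarith
  nlinarith [klFun_nonneg (zero_le_one.trans hx)]

theorem one_sub_sq_le_two_mul_eklFun (x : ℝ≥0∞) : (1 - x) ^ 2 ≤ 2 * eklFun x := by
  rcases le_total 1 x with hx | hx
  · simp [tsub_eq_zero_of_le hx]
  lift x to ℝ≥0 using ne_top_of_le_ne_top ENNReal.one_ne_top hx
  have hx : x ≤ 1 := mod_cast hx
  rw [eklFun_coe, ← ENNReal.ofReal_ofNat 2, ← ENNReal.ofReal_mul zero_le_two]
  refine le_trans (le_of_eq ?_) (ENNReal.ofReal_le_ofReal (sq_one_sub_le_two_mul_klFun x.2 hx))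
  rw [← NNReal.coe_one, ← NNReal.coe_sub hx, ← NNReal.coe_pow, ENNReal.ofReal_coe_nnreal]
  push_cast
  rfl

theorem mul_one_sub_inv_sq_le_two_mul_eklFun {x : ℝ≥0∞} (hx : x ≠ ∞) :
    x * (1 - x⁻¹) ^ 2 ≤ 2 * eklFun x := by
  lift x to ℝ≥0 using hx
  rcases lt_or_ge x 1 with hx | hx
  · rw [tsub_eq_zero_of_le (ENNReal.one_le_inv.2 (mod_cast hx.le))]
    simp
  have hx₀ : 0 < x := one_pos.trans_le hx
  rw [eklFun_coe, ← ENNReal.ofReal_ofNat 2, ← ENNReal.ofReal_mul zero_le_two]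
  have hreal : (x : ℝ) * (1 - (x : ℝ)⁻¹) ^ 2 ≤ 2 * klFun x := by
    have hsq := sq_sub_one_le_two_mul_self_mul_klFun (x := x) hx
    have hx₀ : (0 : ℝ) < x := hx₀
    rw [show (x : ℝ) * (1 - (x : ℝ)⁻¹) ^ 2 = (x - 1) ^ 2 / x by field_simp, div_le_iff₀ hx₀]
    linarith
  refine le_trans (le_of_eq ?_) (ENNReal.ofReal_le_ofReal hreal)
  rw [← NNReal.coe_one, ← NNReal.coe_inv, ← NNReal.coe_sub (inv_le_one_of_one_le₀ hx),
    ← NNReal.coe_pow, ← NNReal.coe_mul, ENNReal.ofReal_coe_nnreal]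
  push_cast [ENNReal.coe_inv hx₀.ne']
  rfl

theorem mul_add_one_le_eklFun_add {x : ℝ≥0∞} (hx : x ≠ ∞) (y L : ℝ≥0) :
    y * x + 1 ≤ eklFun x + L * x + ENNReal.ofReal (Real.exp (y - L)) := by
  lift x to ℝ≥0 using hx
  have hreal : (y : ℝ) * x + 1 ≤ klFun x + L * x + Real.exp (y - L) := by
    rcases eq_zero_or_pos x with rfl | hx
    · simp [klFun, Real.exp_nonneg]
    have hx : (0 : ℝ) < x := hx
    have hexp : Real.exp (y - L) = x * Real.exp (y - L - Real.log x) := by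
      rw [Real.exp_sub _ (Real.log _), Real.exp_log hx, mul_div_cancel₀ _ hx.ne']
    rw [klFun, hexp]
    nlinarith [Real.add_one_le_exp (y - L - Real.log x)]
  have hx₀ : 0 ≤ klFun x := klFun_nonneg x.2
  rw [eklFun_coe]
  simp only [← ENNReal.ofReal_coe_nnreal, ← ENNReal.ofReal_one]
  simp (disch := positivity) only [← ENNReal.ofReal_mul, ← ENNReal.ofReal_add]
  exact ENNReal.ofReal_le_ofReal hreal

variable {Ω : Type*} {mΩ : MeasurableSpace Ω} {μ : Measure Ω}

theorem sq_lintegral_mul_le {f g : Ω → ℝ≥0∞} (hf : AEMeasurable f μ) (hg : AEMeasurable g μ) :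
    (∫⁻ z, f z * g z ∂μ) ^ 2 ≤ (∫⁻ z, f z ^ 2 ∂μ) * ∫⁻ z, g z ^ 2 ∂μ := by
  have h := pow_le_pow_left' (ENNReal.lintegral_mul_le_Lp_mul_Lq μ Real.HolderConjugate.two_two
    hf hg) 2
  have hsq (x : ℝ≥0∞) : (x ^ (1 / 2 : ℝ)) ^ 2 = x := by
    rw [← ENNReal.rpow_two, ← ENNReal.rpow_mul, one_div_mul_cancel two_ne_zero, ENNReal.rpow_one]
  simpa only [ENNReal.rpow_two, Pi.mul_apply, mul_pow, hsq] using h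

variable {D : Ω → ℝ≥0∞} {ψ : Ω → ℝ≥0} {L : ℝ≥0}

theorem sq_lintegral_mul_sub_one_le_of_ne_top (hψ : Measurable ψ) (hD : Measurable D)
    (hfin : ∀ᵐ z ∂μ, D z ≠ ∞) :
    (∫⁻ z, ψ z * (D z - 1) ∂μ) ^ 2 ≤
      (∫⁻ z, (ψ z : ℝ≥0∞) ^ 2 * D z ∂μ) * (2 * ∫⁻ z, eklFun (D z) ∂μ) := by
  have hchange {f : Ω → ℝ≥0∞} (hf : Measurable f) :
      ∫⁻ z, f z ∂μ.withDensity D = ∫⁻ z, f z * D z ∂μ := by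
    simp only [lintegral_withDensity_eq_lintegral_mul _ hD hf, Pi.mul_apply, mul_comm]
  calc (∫⁻ z, ψ z * (D z - 1) ∂μ) ^ 2
      = (∫⁻ z, ψ z * (1 - (D z)⁻¹) ∂μ.withDensity D) ^ 2 := by
        rw [hchange (by fun_prop)]
        congr 1
        refine lintegral_congr_ae (hfin.mono fun z hz => ?_)
        rcases eq_or_ne (D z) 0 with h0 | h0
        · simp [h0]
        · simp only
          rw [mul_assoc, ENNReal.sub_mul fun _ _ => hz, one_mul, ENNReal.inv_mul_cancel h0 hz]
    _ ≤ (∫⁻ z, (ψ z : ℝ≥0∞) ^ 2 ∂μ.withDensity D) *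
          ∫⁻ z, (1 - (D z)⁻¹) ^ 2 ∂μ.withDensity D :=
        sq_lintegral_mul_le (by fun_prop) (by fun_prop)
    _ ≤ (∫⁻ z, (ψ z : ℝ≥0∞) ^ 2 * D z ∂μ) * (2 * ∫⁻ z, eklFun (D z) ∂μ) := by
        rw [hchange (by fun_prop), hchange (by fun_prop), ← lintegral_const_mul 2 (by fun_prop)]
        refine mul_le_mul_right (lintegral_mono_ae (hfin.mono fun z hz => ?_)) _
        rw [mul_comm]
        exact mul_one_sub_inv_sq_le_two_mul_eklFun hz

variable [IsProbabilityMeasure μ]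

theorem lintegral_mul_le_lintegral_eklFun_add {G : Ω → ℝ≥0} (hG : Measurable G) (hD : Measurable D)
    (hL : ∫⁻ z, ENNReal.ofReal (Real.exp (G z - L)) ∂μ ≤ 1) (hD1 : ∫⁻ z, D z ∂μ = 1) :
    ∫⁻ z, G z * D z ∂μ ≤ ∫⁻ z, eklFun (D z) ∂μ + L := by
  have hfin : ∀ᵐ z ∂μ, D z < ∞ := ae_lt_top hD (hD1.trans_ne ENNReal.one_ne_top)
  have hYoung := lintegral_mono_ae (μ := μ) (hfin.mono fun z hz =>
    mul_add_one_le_eklFun_add hz.ne (G z) L)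
  rw [lintegral_add_left (by fun_prop), lintegral_add_left (by fun_prop),
    lintegral_add_left (by fun_prop), lintegral_const_mul _ hD, hD1] at hYoung
  simp only [lintegral_const, measure_univ, mul_one] at hYoung
  exact (ENNReal.add_le_add_iff_right ENNReal.one_ne_top).1 (hYoung.trans (by gcongr))

theorem lintegral_sq_mul_le_lintegral_eklFun_add (hψ : Measurable ψ) (hD : Measurable D)
    (hL : ∫⁻ z, ENNReal.ofReal (Real.exp (ψ z ^ 2 - L)) ∂μ ≤ 1) (hD1 : ∫⁻ z, D z ∂μ = 1) :
    ∫⁻ z, (ψ z : ℝ≥0∞) ^ 2 * D z ∂μ ≤ ∫⁻ z, eklFun (D z) ∂μ + L := by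
  have h := lintegral_mul_le_lintegral_eklFun_add (G := fun z => ψ z ^ 2) (by fun_prop) hD
    (by simpa only [NNReal.coe_pow] using hL) hD1
  simp only [ENNReal.coe_pow] at h
  exact h

theorem sq_lintegral_mul_le_of_lintegral_exp_le (hψ : Measurable ψ)
    (hL : ∫⁻ z, ENNReal.ofReal (Real.exp (ψ z ^ 2 - L)) ∂μ ≤ 1) {f : Ω → ℝ≥0∞}
    (hf : Measurable f) :
    (∫⁻ z, ψ z * f z ∂μ) ^ 2 ≤ L * ∫⁻ z, f z ^ 2 ∂μ := by
  refine (sq_lintegral_mul_le (by fun_prop) hf.aemeasurable).trans ?_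
  gcongr
  simpa [eklFun_one] using
    lintegral_sq_mul_le_lintegral_eklFun_add (D := fun _ => 1) hψ measurable_const hL (by simp)

theorem sq_lintegral_mul_sub_one_le (hψ : Measurable ψ) (hD : Measurable D)
    (hL : ∫⁻ z, ENNReal.ofReal (Real.exp (ψ z ^ 2 - L)) ∂μ ≤ 1) (hD1 : ∫⁻ z, D z ∂μ = 1) :
    (∫⁻ z, ψ z * (D z - 1) ∂μ) ^ 2 ≤ (1 + L) * (2 * ∫⁻ z, eklFun (D z) ∂μ) := by
  have hGibbs := lintegral_sq_mul_le_lintegral_eklFun_add hψ hD hL hD1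
  rcases le_total (∫⁻ z, eklFun (D z) ∂μ) 1 with hle | hge
  · have hfin : ∀ᵐ z ∂μ, D z ≠ ∞ :=
      (ae_lt_top hD (hD1.trans_ne ENNReal.one_ne_top)).mono fun _ h => h.ne
    refine (sq_lintegral_mul_sub_one_le_of_ne_top hψ hD hfin).trans ?_
    gcongr
    exact hGibbs.trans (by gcongr)
  · have : IsProbabilityMeasure (μ.withDensity D) := ⟨by simpa using hD1⟩
    have hJensen : (∫⁻ z, ψ z * D z ∂μ) ^ 2 ≤ ∫⁻ z, (ψ z : ℝ≥0∞) ^ 2 * D z ∂μ := by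
      have h := sq_lintegral_mul_le (μ := μ.withDensity D) (f := fun z => (ψ z : ℝ≥0∞)) (g := 1)
        (by fun_prop) aemeasurable_one
      simp only [Pi.one_apply, mul_one, one_pow, lintegral_const, measure_univ] at h
      rw [lintegral_withDensity_eq_lintegral_mul _ hD (by fun_prop),
        lintegral_withDensity_eq_lintegral_mul _ hD (by fun_prop)] at h
      simpa only [Pi.mul_apply, mul_comm] using h
    calc (∫⁻ z, ψ z * (D z - 1) ∂μ) ^ 2 ≤ (∫⁻ z, ψ z * D z ∂μ) ^ 2 := by
          gcongr
          exact tsub_le_self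
      _ ≤ ∫⁻ z, eklFun (D z) ∂μ + L := hJensen.trans hGibbs
      _ ≤ 2 * ∫⁻ z, eklFun (D z) ∂μ + L * (2 * ∫⁻ z, eklFun (D z) ∂μ) := by
          have htwo : ∫⁻ z, eklFun (D z) ∂μ ≤ 2 * ∫⁻ z, eklFun (D z) ∂μ :=
            le_mul_of_one_le_left' one_le_two
          gcongr
          exact le_mul_of_one_le_right' (hge.trans htwo)
      _ = (1 + L) * (2 * ∫⁻ z, eklFun (D z) ∂μ) := by ring

end Entropy

section RelativeEntropy

variable {Ω : Type*} {mΩ : MeasurableSpace Ω} {μ : Measure Ω} {F : Filtration ℕ mΩ}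
  {b : ℕ → Ω → ℝ≥0∞} {s t T : ℕ}

theorem transitionDensity_one : transitionDensity (1 : ℕ → Ω → ℝ≥0∞) s t = 1 := by
  simp [transitionDensity]

theorem sum_transitionDensity_inf_mul_one_sub (b : ℕ → Ω → ℝ≥0∞) (T : ℕ) :
    transitionDensity (1 ⊓ b) 0 T +
      ∑ s ∈ Finset.range T, transitionDensity (1 ⊓ b) 0 s * (1 - b s) = 1 := by
  simpa [excessDensity, transitionDensity_one, transitionDensity_self] using
    transitionDensity_inf_add_sum_excessDensity 1 b T.zero_le

theorem sq_transitionDensity_inf_mul_one_sub_le (b : ℕ → Ω → ℝ≥0∞) (s : ℕ) (z : Ω) :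
    (transitionDensity (1 ⊓ b) 0 s z * (1 - b s z)) ^ 2 ≤
      2 * (transitionDensity b 0 s z * eklFun (b s z)) := by
  have hone : transitionDensity (1 ⊓ b) 0 s z ≤ 1 :=
    (transitionDensity_inf_le z).trans_eq (congrFun transitionDensity_one z)
  have hsq : transitionDensity (1 ⊓ b) 0 s z ^ 2 ≤ transitionDensity b 0 s z := by
    refine (pow_le_of_le_one zero_le hone two_ne_zero).trans ?_
    rw [transitionDensity_inf_comm]
    exact transitionDensity_inf_le z
  rw [mul_pow, mul_left_comm]
  exact mul_le_mul' hsq (one_sub_sq_le_two_mul_eklFun _)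

theorem sq_one_sub_transitionDensity_inf_le (b : ℕ → Ω → ℝ≥0∞) (T : ℕ) (z : Ω) :
    (1 - transitionDensity (1 ⊓ b) 0 T z) ^ 2 ≤
      T * (2 * ∑ s ∈ Finset.range T, transitionDensity b 0 s z * eklFun (b s z)) := by
  have hsum : 1 - transitionDensity (1 ⊓ b) 0 T z ≤
      ∑ s ∈ Finset.range T, transitionDensity (1 ⊓ b) 0 s z * (1 - b s z) := by
    have h := congrFun (sum_transitionDensity_inf_mul_one_sub b T) z
    simp only [Pi.add_apply, Finset.sum_apply, Pi.mul_apply, Pi.sub_apply, Pi.one_apply] at h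
    exact tsub_le_iff_left.2 h.ge
  have hCS := ENNReal.rpow_sum_le_const_mul_sum_rpow (Finset.range T)
    (fun s => transitionDensity (1 ⊓ b) 0 s z * (1 - b s z)) one_le_two
  norm_num at hCS
  rw [Finset.mul_sum]
  exact (pow_le_pow_left' hsum 2).trans <| hCS.trans <| mul_le_mul_right
    (Finset.sum_le_sum fun s _ => sq_transitionDensity_inf_mul_one_sub_le b s z) _

namespace IsDensityRatio

variable [IsFiniteMeasure μ]

theorem one : IsDensityRatio μ F 1 where
  measurable _ := measurable_const
  condLExp_eq_one s := .of_eq (condLExp_one (F.le s) μ)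

theorem lintegral_mul (hb : IsDensityRatio μ F b) {g : Ω → ℝ≥0∞} (hg : Measurable[F s] g) :
    ∫⁻ z, g z * b s z ∂μ = ∫⁻ z, g z ∂μ := by
  rw [← lintegral_mul_condLExp (F.le s) hg (hb.measurable' s).aemeasurable]
  refine lintegral_congr_ae ?_
  filter_upwards [hb.condLExp_eq_one s] with z hz
  rw [hz, Pi.one_apply, mul_one]

theorem lintegral_eklFun_transitionDensity_succ (hb : IsDensityRatio μ F b) (s : ℕ) :
    ∫⁻ z, eklFun (transitionDensity b 0 (s + 1) z) ∂μ =
      ∫⁻ z, eklFun (transitionDensity b 0 s z) ∂μ +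
        ∫⁻ z, transitionDensity b 0 s z * eklFun (b s z) ∂μ := by
  set M := transitionDensity b 0 s
  have hM : Measurable[F s] M := measurable_transitionDensity hb.measurable
  have hM' : Measurable M := hb.measurable_transitionDensity'
  have hbs : Measurable (b s) := hb.measurable' s
  have hM1 : ∫⁻ z, M z ∂μ = μ Set.univ := hb.lintegral_transitionDensity s.zero_le
  have hb1 : ∫⁻ z, b s z ∂μ = μ Set.univ := by
    simpa using hb.lintegral_mul (g := 1) (s := s) (@measurable_one _ _ _ (F s) _)
  have hfin : ∀ᵐ z ∂μ, b s z ≠ ∞ :=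
    (ae_lt_top hbs (hb1.trans_ne (measure_ne_top _ _))).mono fun _ h => h.ne
  have hint : ∫⁻ z, eklFun ((M * b s) z) + M z + b s z ∂μ =
      ∫⁻ z, eklFun (M z) * b s z + M z * eklFun (b s z) + 1 + M z * b s z ∂μ := by
    refine lintegral_congr_ae ?_
    filter_upwards [hb.transitionDensity_ae_ne_top s.zero_le, hfin] with z hMz hbz
    rw [Pi.mul_apply, eklFun_mul_add_add hMz hbz, mul_comm (b s z)]
  rw [lintegral_add_left (by fun_prop), lintegral_add_left (by fun_prop),
    lintegral_add_left (by fun_prop), lintegral_add_left (by fun_prop),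
    lintegral_add_left (by fun_prop), hb.lintegral_mul hM,
    hb.lintegral_mul (g := fun z => eklFun (M z)) (measurable_eklFun.comp hM), hM1, hb1,
    lintegral_one] at hint
  rw [transitionDensity_succ s.zero_le]
  exact (ENNReal.add_left_inj (measure_ne_top μ _)).1
    ((ENNReal.add_left_inj (measure_ne_top μ _)).1 hint)

theorem lintegral_eklFun_transitionDensity (hb : IsDensityRatio μ F b) (T : ℕ) :
    ∫⁻ z, eklFun (transitionDensity b 0 T z) ∂μ =
      ∑ s ∈ Finset.range T, ∫⁻ z, transitionDensity b 0 s z * eklFun (b s z) ∂μ := by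
  induction T with
  | zero => simp [transitionDensity_self, eklFun_one]
  | succ T ih => rw [hb.lintegral_eklFun_transitionDensity_succ, ih, Finset.sum_range_succ]

theorem lintegral_sq_one_sub_transitionDensity_inf_le (hb : IsDensityRatio μ F b) (T : ℕ) :
    ∫⁻ z, (1 - transitionDensity (1 ⊓ b) 0 T z) ^ 2 ∂μ ≤
      T * (2 * ∫⁻ z, eklFun (transitionDensity b 0 T z) ∂μ) := by
  have hM := fun s => hb.measurable_transitionDensity' (s := 0) (t := s)
  have hbm := hb.measurable'
  refine (lintegral_mono (sq_one_sub_transitionDensity_inf_le b T)).trans_eq ?_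
  rw [lintegral_const_mul _ (by fun_prop), lintegral_const_mul _ (by fun_prop),
    lintegral_finsetSum _ fun s _ => by fun_prop, hb.lintegral_eklFun_transitionDensity]

theorem lintegral_separated_le {μ : Measure Ω} [IsProbabilityMeasure μ]
    (hb : IsDensityRatio μ F b) (T : ℕ) {ψ : Ω → ℝ≥0} {L : ℝ≥0} (hψ : Measurable ψ)
    (hL : ∫⁻ z, ENNReal.ofReal (Real.exp (ψ z ^ 2 - L)) ∂μ ≤ 1) :
    ∫⁻ z, ψ z * (1 - transitionDensity (1 ⊓ b) 0 T z) ∂μ +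
        ∫⁻ z, ψ z * (transitionDensity b 0 T z - transitionDensity (1 ⊓ b) 0 T z) ∂μ ≤
      ENNReal.ofReal (2 * √T + 1) *
        ((1 + L) * (2 * ∫⁻ z, eklFun (transitionDensity b 0 T z) ∂μ)) ^ (1 / 2 : ℝ) := by
  have hD : Measurable (transitionDensity b 0 T) := hb.measurable_transitionDensity'
  have hw : Measurable (transitionDensity (1 ⊓ b) 0 T) := one.measurable_inf' hb
  set D := transitionDensity b 0 T
  set w := transitionDensity (1 ⊓ b) 0 T
  set K := (1 + L) * (2 * ∫⁻ z, eklFun (D z) ∂μ)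
  have hsqrt {x c : ℝ≥0∞} (h : x ^ 2 ≤ c) : x ≤ c ^ (1 / 2 : ℝ) := by
    rwa [one_div, ENNReal.le_rpow_inv_iff two_pos, ENNReal.rpow_two]
  have hX : ∫⁻ z, ψ z * (1 - w z) ∂μ ≤ ENNReal.ofReal √T * K ^ (1 / 2 : ℝ) := by
    rw [Real.sqrt_eq_rpow, ← ENNReal.ofReal_rpow_of_nonneg T.cast_nonneg (by norm_num),
      ENNReal.ofReal_natCast, ← ENNReal.mul_rpow_of_nonneg _ _ (by norm_num)]
    refine hsqrt ((sq_lintegral_mul_le_of_lintegral_exp_le hψ hL (by fun_prop)).trans ?_)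
    rw [mul_left_comm (T : ℝ≥0∞)]
    exact mul_le_mul' le_add_self (hb.lintegral_sq_one_sub_transitionDensity_inf_le T)
  have hY : ∫⁻ z, ψ z * (D z - 1) ∂μ ≤ K ^ (1 / 2 : ℝ) :=
    hsqrt (sq_lintegral_mul_sub_one_le hψ hD hL
      ((hb.lintegral_transitionDensity T.zero_le).trans measure_univ))
  have hDw : ∫⁻ z, ψ z * (D z - w z) ∂μ ≤
      ∫⁻ z, ψ z * (D z - 1) ∂μ + ∫⁻ z, ψ z * (1 - w z) ∂μ := by
    rw [← lintegral_add_left (by fun_prop)]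
    refine lintegral_mono fun z => ?_
    rw [← mul_add]
    exact mul_le_mul_right tsub_le_tsub_add_tsub _
  calc ∫⁻ z, ψ z * (1 - w z) ∂μ + ∫⁻ z, ψ z * (D z - w z) ∂μ
    _ ≤ ENNReal.ofReal √T * K ^ (1 / 2 : ℝ) +
          (K ^ (1 / 2 : ℝ) + ENNReal.ofReal √T * K ^ (1 / 2 : ℝ)) :=
        add_le_add hX (hDw.trans (add_le_add hY hX))
    _ = ENNReal.ofReal (2 * √T + 1) * K ^ (1 / 2 : ℝ) := by
        rw [ENNReal.ofReal_add (by positivity) zero_le_one, ENNReal.ofReal_mul zero_le_two,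
          ENNReal.ofReal_ofNat, ENNReal.ofReal_one]
        ring

end IsDensityRatio

end RelativeEntropy

section DisintegratedDensity

variable {Ω : Type*} {mΩ : MeasurableSpace Ω} {μ : Measure Ω} {F : Filtration ℕ mΩ}
  {D : Ω → ℝ≥0∞} {T : ℕ}

/-- The ratio of the densities of `μ.withDensity D` with respect to `μ` on `F (s + 1)` and on `F s`,
set to `1` where the latter vanishes; there the former, and so the second summand, vanishes as
well, up to a null set. -/
noncomputable def densityRatio (μ : Measure Ω) (F : Filtration ℕ mΩ) (D : Ω → ℝ≥0∞) (s : ℕ) :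
    Ω → ℝ≥0∞ :=
  (μ⁻[D|F s] ⁻¹' {0}).indicator 1 + (μ⁻[D|F s])⁻¹ * μ⁻[D|F (s + 1)]

variable [IsFiniteMeasure μ]

theorem isDensityRatio_densityRatio (hD : ∫⁻ z, D z ∂μ ≠ ∞) :
    IsDensityRatio μ F (densityRatio μ F D) where
  measurable s := by
    have hs : Measurable[F (s + 1)] (μ⁻[D|F s]) :=
      (measurable_condLExp _ _ _).mono (F.mono s.le_succ) le_rfl
    exact (Measurable.indicator (@measurable_one _ _ _ (F (s + 1)) _)
      (hs (measurableSet_singleton 0))).add (hs.inv.mul (measurable_condLExp _ _ _))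
  condLExp_eq_one s := by
    have hs : Measurable[F s] (μ⁻[D|F s]) := measurable_condLExp _ _ _
    have hind : Measurable[F s] ((μ⁻[D|F s] ⁻¹' {0}).indicator (1 : Ω → ℝ≥0∞)) :=
      Measurable.indicator (@measurable_one _ _ _ (F s) _) (hs (measurableSet_singleton 0))
    filter_upwards [condLExp_add_left (mΩ := F s) (P := μ) ((μ⁻[D|F s])⁻¹ * μ⁻[D|F (s + 1)])
        (hind.mono (F.le s) le_rfl).aemeasurable,
      condLExp_mul_left (F.le s) hs.inv (measurable_condLExp' (F (s + 1)) μ D).aemeasurable,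
      condLExp_condLExp_of_le (μ := μ) (f := D) (F.mono s.le_succ) (F.le (s + 1)),
      condLExp_ne_top (mΩ := F s) hD] with z hadd hmul htower hfin
    rw [densityRatio, hadd, Pi.add_apply, condLExp_eq_self (F.le s) μ hind, hmul, Pi.mul_apply,
      htower, Pi.inv_apply]
    by_cases hz : (μ⁻[D|F s]) z = 0
    · simp [hz]
    · simp [hz, ENNReal.inv_mul_cancel hz hfin]

theorem condLExp_mul_densityRatio (hD : ∫⁻ z, D z ∂μ ≠ ∞) (s : ℕ) :
    μ⁻[D|F s] * densityRatio μ F D s =ᵐ[μ] μ⁻[D|F (s + 1)] := by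
  filter_upwards [condLExp_ne_top (mΩ := F s) hD,
    condLExp_condLExp_of_le (μ := μ) (f := D) (F.mono s.le_succ) (F.le (s + 1)),
    eq_zero_of_condLExp_eq_zero (F.le s) (measurable_condLExp' (F (s + 1)) μ D).aemeasurable]
    with z hfin htower hzero
  rw [htower] at hzero
  by_cases hz : (μ⁻[D|F s]) z = 0
  · simp [hz, hzero hz]
  · simp [densityRatio, hz, ← mul_assoc, ENNReal.mul_inv_cancel hz hfin]

theorem transitionDensity_densityRatio (hD : Measurable[F T] D) (hD₀ : μ⁻[D|F 0] =ᵐ[μ] 1) :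
    transitionDensity (densityRatio μ F D) 0 T =ᵐ[μ] D := by
  have hfin : ∫⁻ z, D z ∂μ ≠ ∞ := by
    rw [← lintegral_condLExp (F.le 0), lintegral_congr_ae hD₀]
    simp
  suffices ∀ t, transitionDensity (densityRatio μ F D) 0 t =ᵐ[μ] μ⁻[D|F t] by
    simpa only [condLExp_eq_self (F.le T) μ hD] using this T
  intro t
  induction t with
  | zero => rw [transitionDensity_self]; exact hD₀.symm
  | succ t ih =>
    rw [transitionDensity_succ t.zero_le]
    exact (ih.mul (ae_eq_refl _)).trans (condLExp_mul_densityRatio hfin t)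

end DisintegratedDensity

section RnDeriv

variable {Ω : Type*} {mΩ : MeasurableSpace Ω} {μ ν : Measure Ω} [IsProbabilityMeasure μ]
  [IsProbabilityMeasure ν] {F : Filtration ℕ mΩ} {T : ℕ}

theorem exists_isDensityRatio_of_absolutelyContinuous (hνμ : ν ≪ μ) (h₀ : F 0 = ⊥)
    (hT : F T = mΩ) : ∃ b, IsDensityRatio μ F b ∧
      μ.withDensity (transitionDensity b 0 T) = ν ∧
      ∫⁻ z, eklFun (transitionDensity b 0 T z) ∂μ = klDiv ν μ := by
  have hD : Measurable[F T] (ν.rnDeriv μ) := by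
    rw [hT]
    exact Measure.measurable_rnDeriv ν μ
  have hD1 : ∫⁻ z, ν.rnDeriv μ z ∂μ = 1 := by
    rw [Measure.lintegral_rnDeriv hνμ, measure_univ]
  have hD₀ : μ⁻[ν.rnDeriv μ|F 0] = 1 := by rw [h₀, condLExp_bot, hD1, Pi.one_def]
  have hlast := transitionDensity_densityRatio hD (.of_eq hD₀)
  refine ⟨densityRatio μ F (ν.rnDeriv μ),
    isDensityRatio_densityRatio (hD1.trans_ne ENNReal.one_ne_top), ?_, ?_⟩
  · rw [withDensity_congr_ae hlast, Measure.withDensity_rnDeriv_eq _ _ hνμ]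
  · rw [klDiv_eq_lintegral_klFun_of_ac hνμ]
    exact lintegral_congr_ae (hlast.mono fun z hz => congrArg eklFun hz)

end RnDeriv

section TransportCost

variable {Ω : Type*} {mΩ : MeasurableSpace Ω} {μ : Measure Ω} [IsProbabilityMeasure μ]

theorem one_le_integral_exp {G : Ω → ℝ} (hG₀ : ∀ z, 0 ≤ G z)
    (hG : Integrable (fun z => Real.exp (G z)) μ) : 1 ≤ ∫ z, Real.exp (G z) ∂μ := by
  simpa using integral_mono (integrable_const 1) hG fun z => Real.one_le_exp (hG₀ z)

theorem lintegral_exp_sub_log_integral_exp {G : Ω → ℝ}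
    (hG : Integrable (fun z => Real.exp (G z)) μ) :
    ∫⁻ z, ENNReal.ofReal (Real.exp (G z - Real.log (∫ x, Real.exp (G x) ∂μ))) ∂μ = 1 := by
  have hpos := integral_exp_pos hG
  simp only [Real.exp_sub, Real.exp_log hpos]
  rw [← ofReal_integral_eq_lintegral_ofReal (hG.div_const _)
    (ae_of_all _ fun z => by positivity), integral_div, div_self hpos.ne', ENNReal.ofReal_one]

theorem dist_rpow_le_mul_add [PseudoMetricSpace Ω] {p : ℝ} (hp : 1 ≤ p) (x₀ x y : Ω) :
    dist x y ^ p ≤ 2 ^ (p - 1) * (dist x x₀ ^ p + dist y x₀ ^ p) :=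
  (Real.rpow_le_rpow dist_nonneg (dist_triangle_right x y x₀) (by positivity)).trans
    (mod_cast NNReal.rpow_add_le_mul_rpow_add_rpow (nndist x x₀) (nndist y x₀) hp)

variable [StandardBorelSpace Ω] {F : Filtration ℕ mΩ} {b : ℕ → Ω → ℝ≥0∞} {T : ℕ}

theorem IsDensityRatio.lintegral_dist_rpow_separationCoupling_le (hb : IsDensityRatio μ F b)
    [PseudoMetricSpace Ω] (hd : Measurable fun z : Ω × Ω => dist z.1 z.2) {p : ℝ} (hp : 1 ≤ p)
    (x₀ : Ω) {α : ℝ} (hα : 0 < α)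
    (hμ : Integrable (fun x => Real.exp (α * dist x x₀ ^ (2 * p))) μ) :
    ∫⁻ z, ENNReal.ofReal (dist z.1 z.2) ^ p ∂separationCoupling μ F T 1 b ≤
      ENNReal.ofReal (2 ^ (p - 1) * (2 * √T + 1) / √α *
        (1 + Real.log (∫ x, Real.exp (α * dist x x₀ ^ (2 * p)) ∂μ)) ^ (1 / 2 : ℝ)) *
        (2 * ∫⁻ z, eklFun (transitionDensity b 0 T z) ∂μ) ^ (1 / 2 : ℝ) := by
  have hp₀ : 0 < p := one_pos.trans_le hp
  have hexp := lintegral_exp_sub_log_integral_exp hμ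
  have hlog := Real.log_nonneg (one_le_integral_exp (fun _ => by positivity) hμ)
  set L := Real.log (∫ x, Real.exp (α * dist x x₀ ^ (2 * p)) ∂μ)
  have hdx₀ : Measurable fun x => dist x x₀ := hd.comp (measurable_id.prodMk measurable_const)
  set ψ : Ω → ℝ≥0 := fun x => (√α * dist x x₀ ^ p).toNNReal with hψdef
  have hψ : Measurable ψ := ((hdx₀.pow_const p).const_mul _).real_toNNReal
  have hψsq (x : Ω) : (ψ x : ℝ) ^ 2 = α * dist x x₀ ^ (2 * p) := by
    rw [hψdef, Real.coe_toNNReal _ (by positivity), mul_pow, Real.sq_sqrt hα.le, mul_comm 2 p,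
      Real.rpow_mul dist_nonneg, Real.rpow_two]
  have hcost (z : Ω × Ω) : ENNReal.ofReal (dist z.1 z.2) ^ p ≤
      ENNReal.ofReal (2 ^ (p - 1) / √α) * (ψ z.1 + ψ z.2) := by
    rw [ENNReal.ofReal_rpow_of_nonneg dist_nonneg hp₀.le, hψdef, ← ENNReal.ofReal, ← ENNReal.ofReal,
      ← ENNReal.ofReal_add (by positivity) (by positivity), ← ENNReal.ofReal_mul (by positivity)]
    refine ENNReal.ofReal_le_ofReal ((dist_rpow_le_mul_add hp x₀ z.1 z.2).trans_eq ?_)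
    field_simp
  have hseparated := hb.lintegral_separated_le T hψ (L := L.toNNReal)
    (by simpa only [hψsq, Real.coe_toNNReal L hlog] using hexp.le)
  refine (one.lintegral_separationCoupling_le hb (hd.ennreal_ofReal.pow_const p)
    hψ.coe_nnreal_ennreal (by simp [hp₀]) hcost).trans ?_
  simp only [transitionDensity_one, Pi.one_apply]
  refine (mul_le_mul_right hseparated _).trans_eq ?_
  rw [ENNReal.mul_rpow_of_nonneg _ _ (by norm_num), ← mul_assoc, ← mul_assoc,
    ← ENNReal.ofReal_mul (by positivity), ← ENNReal.ofReal, ← ENNReal.ofReal_one,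
    ← ENNReal.ofReal_add zero_le_one hlog,
    ENNReal.ofReal_rpow_of_nonneg (by positivity) (by norm_num),
    ← ENNReal.ofReal_mul (by positivity)]
  congr 3
  ring

end TransportCost

section Path

variable {T : ℕ} {X : Fin T → Type*} [∀ i, MeasurableSpace (X i)]

/-- The filtration generated by the coordinate process on the path space. -/
def pathFiltration (X : Fin T → Type*) [∀ i, MeasurableSpace (X i)] :
    Filtration ℕ (MeasurableSpace.pi : MeasurableSpace (∀ i, X i)) where
  seq t := MeasurableSpace.comap (pathUpTo t) inferInstance
  mono' s t hst := by
    have hrestrict : Measurable fun (y : ∀ i : {i : Fin T // i.val < t}, X i.val)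
        (i : {i : Fin T // i.val < s}) => y ⟨i.val, i.2.trans_le hst⟩ :=
      measurable_pi_lambda _ fun _ => measurable_pi_apply _
    exact (hrestrict.comp (comap_measurable (pathUpTo t))).comap_le
  le' t := (measurable_pathUpTo t).comap_le

theorem pathFiltration_zero : pathFiltration X 0 = ⊥ := by
  have : Subsingleton (∀ i : {i : Fin T // i.val < 0}, X i.val) :=
    ⟨fun _ _ => funext fun i => absurd i.2 (Nat.not_lt_zero _)⟩
  change MeasurableSpace.comap (pathUpTo 0) MeasurableSpace.pi = ⊥
  rw [Subsingleton.elim (pathUpTo (X := X) 0) fun _ i => absurd i.2 (Nat.not_lt_zero _),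
    MeasurableSpace.comap_const]

theorem pathFiltration_last : pathFiltration X T = MeasurableSpace.pi := by
  refine le_antisymm ((pathFiltration X).le T) (iSup_le fun i => ?_)
  have hi : Measurable fun y : ∀ i : {i : Fin T // i.val < T}, X i.val => y ⟨i, i.2⟩ :=
    measurable_pi_apply _
  exact (hi.comp (comap_measurable (pathUpTo T))).comap_le

variable [∀ i, StandardBorelSpace (X i)] {μ ν : Measure (∀ i, X i)}

theorem adaptedWasserstein_rpow_le {d : (∀ i, X i) → (∀ i, X i) → ℝ} {p : ℝ} (hp : 0 < p)
    {π : Measure ((∀ i, X i) × (∀ i, X i))} [IsProbabilityMeasure π]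
    (hπ : IsBicausalCoupling π μ ν) :
    adaptedWasserstein d p μ ν ^ p ≤ ∫⁻ z, ENNReal.ofReal (d z.1 z.2) ^ p ∂π := by
  rw [← ENNReal.le_rpow_inv_iff hp, ← one_div]
  exact iInf₂_le (⟨π, inferInstance⟩ : ProbabilityMeasure _) hπ

theorem IsDensityRatio.isBicausalCoupling_separationCoupling [IsFiniteMeasure μ]
    {a b : ℕ → (∀ i, X i) → ℝ≥0∞} (ha : IsDensityRatio μ (pathFiltration X) a)
    (hb : IsDensityRatio μ (pathFiltration X) b)
    [IsFiniteMeasure (separationCoupling μ (pathFiltration X) T a b)] :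
    IsBicausalCoupling (separationCoupling μ (pathFiltration X) T a b)
      (μ.withDensity (transitionDensity a 0 T)) (μ.withDensity (transitionDensity b 0 T)) where
  map_fst := ha.map_fst_separationCoupling hb
  map_snd := ha.map_snd_separationCoupling hb
  causal t _ ht := by
    refine condIndepFun_of_lintegral_condLExp measurable_fst measurable_snd
      (measurable_pathUpTo t) fun f g hf hg => ?_
    rw [ha.map_fst_separationCoupling hb]
    exact ha.lintegral_separationCoupling_condLExp hb ht.le hf hg
  anticausal t _ ht := by
    refine condIndepFun_of_lintegral_condLExp measurable_snd measurable_fst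
      (measurable_pathUpTo t) fun f g hf hg => ?_
    have hg' : Measurable g := hg.mono (measurable_pathUpTo t).comap_le le_rfl
    simp only [mul_comm _ (g _)]
    rw [ha.map_snd_separationCoupling hb,
      ha.lintegral_separationCoupling_swap hb hg' (measurable_condLExp' _ _ _),
      ha.lintegral_separationCoupling_swap hb hg' hf]
    exact hb.lintegral_separationCoupling_condLExp ha ht.le hf hg

theorem corollary1p6_general (m : PseudoMetricSpace (∀ i, X i))
    (hd : Measurable fun z : (∀ i, X i) × (∀ i, X i) => m.dist z.1 z.2) {p : ℝ} (hp : 1 ≤ p)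
    [IsProbabilityMeasure μ] (x₀ : ∀ i, X i) {α : ℝ} (hα : 0 < α)
    (hμ : Integrable (fun x => Real.exp (α * m.dist x x₀ ^ (2 * p))) μ)
    [IsProbabilityMeasure ν] :
    adaptedWasserstein m.dist p μ ν ^ p ≤
      ENNReal.ofReal
        (2 ^ (p - 1) * (2 * √(T : ℝ) + 1) / √α *
          (1 + Real.log (∫ x, Real.exp (α * m.dist x x₀ ^ (2 * p)) ∂μ)) ^ (1 / 2 : ℝ)) *
        (2 * klDiv ν μ) ^ (1 / 2 : ℝ) := by
  by_cases hνμ : ν ≪ μ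
  · obtain ⟨b, hb, rfl, hkl⟩ := exists_isDensityRatio_of_absolutelyContinuous hνμ
      pathFiltration_zero (pathFiltration_last (X := X))
    have hprob := IsDensityRatio.one.isProbabilityMeasure_separationCoupling hb (T := T)
    have hπ := IsDensityRatio.one.isBicausalCoupling_separationCoupling hb
    rw [transitionDensity_one, withDensity_one] at hπ
    rw [← hkl]
    exact (adaptedWasserstein_rpow_le (one_pos.trans_le hp) hπ).trans
      (hb.lintegral_dist_rpow_separationCoupling_le hd hp x₀ hα hμ)
  · have hlog := Real.log_nonneg (one_le_integral_exp (fun x => by positivity) hμ)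
    rw [klDiv_of_not_ac hνμ, ENNReal.mul_top two_ne_zero, ENNReal.top_rpow_of_pos (by norm_num),
      ENNReal.mul_top (ENNReal.ofReal_pos.2 (by positivity)).ne']
    exact le_top

end Path

theorem corollary1p6 {T : ℕ} {X : Fin T → Type*}
    [∀ i, TopologicalSpace (X i)] [∀ i, PolishSpace (X i)]
    [∀ i, MeasurableSpace (X i)] [∀ i, BorelSpace (X i)]
    -- `m` is any metric on the product that metrizes the product topology
    (m : MetricSpace (∀ i, X i))
    (hm : m.toUniformSpace.toTopologicalSpace = Pi.topologicalSpace)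
    (p : ℝ) (hp : 1 < p)
    (μ : Measure (∀ i, X i)) [IsProbabilityMeasure μ]
    (x₀ : ∀ i, X i) (α : ℝ) (hα : 0 < α)
    (hμ : Integrable (fun x => Real.exp (α * m.dist x x₀ ^ (2 * p))) μ)
    (ν : Measure (∀ i, X i)) [IsProbabilityMeasure ν] :
    adaptedWasserstein m.dist p μ ν ^ p ≤
      ENNReal.ofReal
        (2 ^ (p - 1) * (2 * √(T : ℝ) + 1) / √α *
          (1 + Real.log (∫ x, Real.exp (α * m.dist x x₀ ^ (2 * p)) ∂μ)) ^ (1 / 2 : ℝ)) *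
        (2 * klDiv ν μ) ^ (1 / 2 : ℝ) := by
  have hc : @Continuous ((∀ i, X i) × (∀ i, X i)) ℝ
      (@instTopologicalSpaceProd _ _ Pi.topologicalSpace Pi.topologicalSpace) _
      (fun z => m.dist z.1 z.2) := by
    rw [← hm]
    exact @continuous_dist _ m.toPseudoMetricSpace
  exact corollary1p6_general m.toPseudoMetricSpace
    (@Continuous.measurable _ _ (@instTopologicalSpaceProd _ _ Pi.topologicalSpace
      Pi.topologicalSpace) _ (@Prod.opensMeasurableSpace _ _ Pi.topologicalSpace _ _
        Pi.topologicalSpace _ _ _) _ _ _ _ hc) hp.le x₀ hα hμ
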